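/- Let $n\ge 2$ be a fixed integer. For each $d\in\mathbb{N}$ let $W=W_d\sim\mathcal{W}_n(I_n,d)$ be a standard real Wishart matrix, that is, an $n\times n$ random matrix with the same distribution as $\sum_{k=1}^{d} v_k v_k^{T}$, where $v_1,\dots,v_d$ are i.i.d. random vectors in $\mathbb{R}^n$ with the Gaussian distribution $\mathcal{N}_n(0,I_n)$. Let $\lambda_1\ge\lambda_2\ge\cdots\ge\lambda_n$ be the ordered eigenvalues of $W$. Then the following two statements hold. 1. If $n$ is even, then for all real $\eta>0$ and $\gamma>\frac{n^2+n-6}{4}\,\eta$, $$\mathbb{P}\Bigl(d^{\frac12-\gamma}\le\min_{1\le k\le n-1}(\lambda_k-\lambda_{k+1})\le d^{\frac12+\eta}\Bigr)\longrightarrow 1\qquad (d\to\infty).$$ 2. If $n$ is odd, then for all real $\eta>0$ and $\gamma>0$ with $\gamma>\frac{n^2+n-6}{4}\,\eta-\frac{n^2+n-2}{8}$, $$\mathbb{P}\Bigl(d^{\frac12-\gamma}\le\min_{1\le k\le n-1}(\lambda_k-\lambda_{k+1})\le d^{\frac12+\eta}\Bigr)\longrightarrow 1\qquad (d\to\infty).$$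 -/

import Mathlib

open MeasureTheory ProbabilityTheory Filter Topology

/-- Real matrices carry the product (equivalently, Borel) σ-algebra of their entries. -/
instance matrixMeasurableSpace (n : ℕ) : MeasurableSpace (Matrix (Fin n) (Fin n) ℝ) :=
  inferInstanceAs (MeasurableSpace (Fin n → Fin n → ℝ))

/-- The Wishart distribution `𝒲_n(Σ, d)`: the law of the `n × n` random matrix
`G₁ G₁ᵀ + ⋯ + G_d G_dᵀ`, where `G₁, …, G_d` are independent random vectors in `ℝⁿ` with the
Gaussian distribution `𝒩_n(0, Σ)`. -/
noncomputable def wishart (n : ℕ) (S : Matrix (Fin n) (Fin n) ℝ) (d : ℕ) :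
    Measure (Matrix (Fin n) (Fin n) ℝ) :=
  (Measure.pi (fun _ : Fin d => multivariateGaussian (0 : EuclideanSpace ℝ (Fin n)) S)).map
    (fun G => ∑ k : Fin d, Matrix.vecMulVec (G k).ofLp (G k).ofLp)

theorem wishart_map_measurable (n d : ℕ) :
    Measurable (fun G : Fin d → EuclideanSpace ℝ (Fin n) =>
      ∑ k : Fin d, Matrix.vecMulVec (G k).ofLp (G k).ofLp) := by
  refine measurable_pi_lambda _ fun i => measurable_pi_lambda _ fun j => ?_
  simp only [Matrix.sum_apply, Matrix.vecMulVec_apply]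
  fun_prop

instance wishart_isProbabilityMeasure (n : ℕ) (S : Matrix (Fin n) (Fin n) ℝ) (d : ℕ) :
    IsProbabilityMeasure (wishart n S d) :=
  Measure.isProbabilityMeasure_map (wishart_map_measurable n d).aemeasurable

/-- The eigenvalues `λ₁ ≥ λ₂ ≥ ⋯ ≥ λ_n` of a real symmetric `n × n` matrix, listed in
non-increasing order with multiplicity (and indexed from `0`). -/
noncomputable def orderedEigenvalue {n : ℕ} {A : Matrix (Fin n) (Fin n) ℝ} (hA : A.IsHermitian)
    (k : Fin n) : ℝ :=
  hA.eigenvalues₀ (Fin.cast (Fintype.card_fin n).symm k)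

/-- The minimum eigengap `min_{1 ≤ k ≤ n - 1} (λ_k - λ_{k+1})` of a real symmetric `n × n` matrix,
`n ≥ 2` (a minimum over a finite nonempty index set). -/
noncomputable def minEigengap {n : ℕ} {A : Matrix (Fin n) (Fin n) ℝ} (hA : A.IsHermitian) : ℝ :=
  ⨅ k : Fin (n - 1),
    (orderedEigenvalue hA ⟨k, by omega⟩ - orderedEigenvalue hA ⟨k + 1, by omega⟩)

/-- The event that the random symmetric matrix `W` has its minimum eigengap in `[a, b]`. A matrix
with a Wishart distribution is symmetric almost surely, so the requirement of symmetry only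
discards a null set. -/
def eigengapEvent {Ω : Type*} {n : ℕ} (W : Ω → Matrix (Fin n) (Fin n) ℝ) (a b : ℝ) : Set Ω :=
  {ω | ∃ hA : (W ω).IsHermitian, a ≤ minEigengap hA ∧ minEigengap hA ≤ b}

/-! By the central limit theorem, `(W - d I) / √d` converges in law to a nondegenerate Gaussian
symmetric matrix. The discriminant of its characteristic polynomial is a nonzero polynomial in the
entries, so it is almost surely nonzero (`ae_hankelDet_symMat_ne_zero`). Hence, with limiting
probability as close to 1 as desired, the normalized matrix has bounded Frobenius norm and
discriminant bounded away from 0. These are open conditions on the entries, so weak convergence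
applies to them without any continuity of eigenvalues.

By `minEigengap_bounds` they confine the normalized minimum gap to a fixed compact subinterval of
`(0, ∞)`. The gap of `W` is then of order `√d`, which lies in the window for large `d` whenever `η,
γ > 0`; both parity cases follow from this. -/

/-! ### Zero sets of polynomials under Gaussian measures -/

/-- The zero set of a nonzero polynomial is null for a product of atomless measures on the line. -/
theorem pi_zeros_eq_zero (k : ℕ) (μ : Fin k → Measure ℝ) [∀ i, SigmaFinite (μ i)]
    [∀ i, NullSingletonClass (μ i)] {p : MvPolynomial (Fin k) ℝ} (hp : p ≠ 0) :
    Measure.pi μ {x | MvPolynomial.eval x p = 0} = 0 := by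
  induction k with
  | zero =>
    obtain ⟨c, rfl⟩ := MvPolynomial.C_surjective (R := ℝ) (Fin 0) p
    have hc : c ≠ 0 := by rintro rfl; simp at hp
    simp [hc]
  | succ k ih =>
    have hq : MvPolynomial.finSuccEquiv ℝ k p ≠ 0 := by simpa using hp
    set q := MvPolynomial.finSuccEquiv ℝ k p with hqdef
    have hlead := ih (fun i => μ i.succ) (Polynomial.leadingCoeff_ne_zero.2 hq)
    have hmeas : MeasurableSet {z : ℝ × (Fin k → ℝ) |
        MvPolynomial.eval (Fin.cons z.1 z.2 : Fin (k + 1) → ℝ) p = 0} := by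
      refine (isClosed_eq ?_ continuous_const).measurableSet
      exact (MvPolynomial.continuous_eval p).comp (by fun_prop)
    have hmp := measurePreserving_piFinSuccAbove μ 0
    have hset : {x | MvPolynomial.eval x p = 0} =
        (MeasurableEquiv.piFinSuccAbove (fun _ => ℝ) 0) ⁻¹' {z : ℝ × (Fin k → ℝ) |
        MvPolynomial.eval (Fin.cons z.1 z.2 : Fin (k + 1) → ℝ) p = 0} := by
      ext x
      simp [MeasurableEquiv.piFinSuccAbove, Fin.insertNthEquiv, Fin.cons_self_tail, Fin.removeNth_zero]
    rw [hset, hmp.measure_preimage hmeas.nullMeasurableSet, Measure.prod_apply_symm hmeas,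
      lintegral_eq_zero_iff (measurable_measure_prodMk_right hmeas)]
    -- Fubini: off the null set where the leading coefficient in the first variable vanishes, each
    -- slice is the root set of a nonzero univariate polynomial, hence finite.
    have hae : ∀ᵐ y ∂(Measure.pi fun i : Fin k => μ i.succ),
        MvPolynomial.eval y q.leadingCoeff ≠ 0 := by
      rw [ae_iff]; simpa using hlead
    simp only [Fin.zero_succAbove]
    filter_upwards [hae] with y hy
    have hne : q.map (MvPolynomial.eval y) ≠ 0 := by
      intro h
      apply hy
      have := congrArg (fun r => Polynomial.coeff r q.natDegree) h
      simpa using this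
    refine Set.Finite.measure_zero ?_ _
    refine ((q.map (MvPolynomial.eval y)).roots.toFinset.finite_toSet).subset ?_
    intro t ht
    simp only [Set.mem_preimage, Set.mem_ofPred_eq] at ht
    simp only [Finset.mem_coe, Multiset.mem_toFinset, Polynomial.mem_roots hne,
      Polynomial.IsRoot.def]
    rwa [MvPolynomial.eval_eq_eval_mv_eval'] at ht

open scoped MatrixOrder in
/-- The zero set of a nonzero polynomial is null for a nondegenerate Gaussian measure. -/
theorem multivariateGaussian_zeros_eq_zero {ι : Type*} [Fintype ι] [DecidableEq ι]
    {S : Matrix ι ι ℝ} (hS : S.PosDef) {p : MvPolynomial ι ℝ} (hp : p ≠ 0) :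
    multivariateGaussian 0 S {x | MvPolynomial.eval x.ofLp p = 0} = 0 := by
  let b := stdOrthonormalBasis ℝ (EuclideanSpace ℝ ι)
  let T := Matrix.toEuclideanCLM (𝕜 := ℝ) (CFC.sqrt S)
  have hT : Function.Surjective T := by
    have hu : IsUnit (CFC.sqrt S) := by
      have h := CFC.sqrt_mul_sqrt_self S hS.posSemidef.nonneg
      have hSu := hS.isUnit
      rw [Matrix.isUnit_iff_isUnit_det] at hSu ⊢
      rw [← h, Matrix.det_mul] at hSu
      exact isUnit_of_mul_isUnit_left hSu
    have hTu : IsUnit T := hu.map (Matrix.toEuclideanCLM (𝕜 := ℝ) (n := ι))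
    obtain ⟨u, hu⟩ := hTu
    intro y
    refine ⟨(↑u⁻¹ : EuclideanSpace ℝ ι →L[ℝ] EuclideanSpace ℝ ι) y, ?_⟩
    rw [← hu, ← mul_apply_eq_comp, u.mul_inv]
    rfl
  -- `r` is `p` in the coordinates in which the Gaussian is the image of a product of standard
  -- normals.
  let r : MvPolynomial (Fin (Module.finrank ℝ (EuclideanSpace ℝ ι))) ℝ :=
    MvPolynomial.bind₁ (fun i => ∑ j, MvPolynomial.C ((T (b j)) i) * MvPolynomial.X j) p
  have hr (x) : MvPolynomial.eval x r = MvPolynomial.eval (T (∑ j, x j • b j)).ofLp p := by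
    simp only [r, MvPolynomial.eval, MvPolynomial.eval₂Hom_bind₁]
    congr 2
    ext i
    simp [mul_comm]
  have hr0 : r ≠ 0 := by
    intro h
    apply hp
    refine MvPolynomial.funext fun y => ?_
    obtain ⟨z, hz⟩ := hT (WithLp.toLp 2 y)
    have := hr (fun j => b.repr z j)
    rw [b.sum_repr z, hz, h] at this
    simpa using this.symm
  have hcl : IsClosed {x : EuclideanSpace ℝ ι | MvPolynomial.eval x.ofLp p = 0} :=
    isClosed_eq ((MvPolynomial.continuous_eval p).comp (by fun_prop)) continuous_const
  rw [multivariateGaussian, stdGaussian, Measure.map_map (by fun_prop) (by fun_prop),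
    Measure.map_apply (by fun_prop) hcl.measurableSet]
  convert pi_zeros_eq_zero _ (fun _ => gaussianReal 0 1) hr0 using 2
  · ext x
    rw [Set.mem_ofPred_eq, hr]
    simp [T, b]
  · exact fun _ => nullSingletonClass_gaussianReal one_ne_zero

/-! ### The multivariate central limit theorem -/

/-- The characteristic function of a normalized sum of independent copies. -/
theorem charFun_map_pi_normalizedSum {Ω E : Type*} [MeasurableSpace Ω] [NormedAddCommGroup E]
    [InnerProductSpace ℝ E] [MeasurableSpace E] [BorelSpace E] [SecondCountableTopology E]
    (P : Measure Ω) [IsProbabilityMeasure P] {Y : Ω → E} (hY : Measurable Y) (d : ℕ) (a : ℝ)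
    (t : E) :
    charFun ((Measure.pi (fun _ : Fin d => P)).map (fun G => a • ∑ k, Y (G k))) t =
      charFun (P.map Y) (a • t) ^ d := by
  have hm : Measurable fun G : Fin d → Ω => a • ∑ k, Y (G k) := by fun_prop
  rw [charFun_apply, charFun_apply, integral_map hm.aemeasurable (by fun_prop),
    integral_map hY.aemeasurable (by fun_prop)]
  have h (G : Fin d → Ω) : Complex.exp (inner ℝ (a • ∑ k, Y (G k)) t * Complex.I) =
      ∏ k, Complex.exp (inner ℝ (Y (G k)) (a • t) * Complex.I) := by
    rw [← Complex.exp_sum, real_inner_smul_left, sum_inner]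
    simp only [real_inner_smul_right, Complex.ofReal_mul, Complex.ofReal_sum, Finset.mul_sum,
      Finset.sum_mul]
  simp_rw [h]
  rw [integral_fintype_prod_eq_prod (f := fun _ x => Complex.exp (inner ℝ (Y x) (a • t) * Complex.I))]
  simp

/-- Pointwise convergence of characteristic functions bounds the limit inferior of the measures of
open sets from below. -/
theorem le_liminf_of_tendsto_charFun {E : Type*} [NormedAddCommGroup E]
    [InnerProductSpace ℝ E] [FiniteDimensional ℝ E] [MeasurableSpace E] [BorelSpace E]
    {μ : ℕ → Measure E} [hμ : ∀ d, IsProbabilityMeasure (μ d)] {ν : Measure E}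
    [hν : IsProbabilityMeasure ν]
    (h : ∀ t, Tendsto (fun d => charFun (μ d) t) atTop (𝓝 (charFun ν t))) {U : Set E}
    (hU : IsOpen U) : ν U ≤ liminf (fun d => μ d U) atTop := by
  have hlim : Tendsto (β := ProbabilityMeasure E) (fun d => ⟨μ d, hμ d⟩) atTop
      (@nhds (ProbabilityMeasure E) _ ⟨ν, hν⟩) :=
    ProbabilityMeasure.tendsto_of_tendsto_charFun h
  exact ProbabilityMeasure.le_liminf_measure_open_of_tendsto hlim hU

/-- The second moment matrix of a random vector. -/
noncomputable def secondMoment {Ω ι : Type*} [MeasurableSpace Ω] (P : Measure Ω)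
    (Y : Ω → EuclideanSpace ℝ ι) : Matrix ι ι ℝ :=
  Matrix.of fun i j => ∫ ω, Y ω i * Y ω j ∂P

section

variable {Ω ι : Type*} [MeasurableSpace Ω] [Fintype ι] {P : Measure Ω}
  {Y : Ω → EuclideanSpace ℝ ι}

theorem memLp_linearCombination (hY2 : ∀ i, MemLp (fun ω => Y ω i) 2 P) (t : ι → ℝ) :
    MemLp (fun ω => ∑ i, t i * Y ω i) 2 P :=
  memLp_finsetSum _ fun i _ => (hY2 i).const_mul _

open Matrix in
theorem dotProduct_secondMoment_mulVec (hY2 : ∀ i, MemLp (fun ω => Y ω i) 2 P) (t : ι → ℝ) :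
    t ⬝ᵥ secondMoment P Y *ᵥ t = ∫ ω, (∑ i, t i * Y ω i) ^ 2 ∂P := by
  have hint (i j) : Integrable (fun ω => Y ω i * Y ω j) P := (hY2 i).integrable_mul (hY2 j)
  have h (ω) : (∑ i, t i * Y ω i) ^ 2 = ∑ i, ∑ j, t i * t j * (Y ω i * Y ω j) := by
    rw [sq, Finset.sum_mul_sum]
    exact Finset.sum_congr rfl fun i _ => Finset.sum_congr rfl fun j _ => by ring
  simp_rw [h]
  rw [integral_finsetSum _ fun i _ => integrable_finsetSum _ fun j _ => (hint i j).const_mul _]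
  simp only [dotProduct, mulVec, secondMoment, Matrix.of_apply, Finset.mul_sum]
  refine Finset.sum_congr rfl fun i _ => ?_
  rw [integral_finsetSum _ fun j _ => (hint i j).const_mul _]
  refine Finset.sum_congr rfl fun j _ => ?_
  rw [integral_const_mul]
  ring

/-- A second moment matrix is positive definite if no nontrivial linear combination of the
coordinates vanishes almost surely. -/
theorem posDef_secondMoment (hY2 : ∀ i, MemLp (fun ω => Y ω i) 2 P)
    (hnd : ∀ t : ι → ℝ, (∀ᵐ ω ∂P, ∑ i, t i * Y ω i = 0) → t = 0) :
    (secondMoment P Y).PosDef := by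
  refine Matrix.PosDef.of_dotProduct_mulVec_pos ?_ fun t ht => ?_
  · ext i j
    simp [secondMoment, mul_comm]
  · rw [star_trivial, dotProduct_secondMoment_mulVec hY2]
    refine lt_of_le_of_ne (integral_nonneg fun ω => sq_nonneg _) fun h => ht (hnd t ?_)
    rw [eq_comm, integral_eq_zero_iff_of_nonneg (fun ω => sq_nonneg _)
      (memLp_linearCombination hY2 t).integrable_sq] at h
    filter_upwards [h] with ω hω
    simpa using hω

variable [DecidableEq ι]

/-- Cramér–Wold: the characteristic function at `t` only involves the scalar variable `⟨Y, t⟩`, to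
which the one-dimensional theorem applies. -/
theorem tendsto_charFun_secondMoment [IsProbabilityMeasure P] (hY : Measurable Y)
    (hY2 : ∀ i, MemLp (fun ω => Y ω i) 2 P) (hY0 : ∀ i, ∫ ω, Y ω i ∂P = 0)
    (hS : (secondMoment P Y).PosDef) (t : EuclideanSpace ℝ ι) :
    Tendsto (fun d : ℕ => charFun (P.map Y) ((√(d : ℝ))⁻¹ • t) ^ d) atTop
      (𝓝 (charFun (multivariateGaussian 0 (secondMoment P Y)) t)) := by
  rw [charFun_multivariateGaussian hS.posSemidef]
  rw [dotProduct_secondMoment_mulVec hY2 t.ofLp]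
  by_cases ht : t = 0
  · have := Measure.isProbabilityMeasure_map (μ := P) hY.aemeasurable
    simp [ht, charFun_zero]
  have hpos := hS.dotProduct_mulVec_pos (x := t.ofLp) (by simpa using ht)
  rw [star_trivial, dotProduct_secondMoment_mulVec hY2] at hpos
  have hL2 := memLp_linearCombination hY2 t.ofLp
  set Z : Ω → ℝ := fun ω => ∑ i, t.ofLp i * Y ω i with hZ
  set v : ℝ := ∫ ω, Z ω ^ 2 ∂P with hv
  have hZm : Measurable Z := by fun_prop
  have hZ0 : ∫ ω, Z ω ∂P = 0 := by
    rw [hZ, integral_finsetSum _ fun i _ => ((hY2 i).integrable (by norm_num)).const_mul _]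
    simp [integral_const_mul, hY0]
  -- `Z / √v` has unit variance; evaluating at `√v` undoes the normalization.
  have key := tendsto_charFun_inv_sqrt_mul_pow (P := P) (X := fun ω => Z ω / √v)
    (by fun_prop) (by simp [integral_div, hZ0])
    (by
      simp only [Pi.pow_apply, div_pow, Real.sq_sqrt hpos.le]
      rw [integral_div, div_self hpos.ne']) (√v)
  convert key using 2
  · rename_i d
    congr 1
    rw [charFun_apply, charFun_apply, integral_map (by fun_prop) (by fun_prop),
      integral_map (by fun_prop) (by fun_prop)]
    congr 1
    ext ω
    congr 3
    have hin : inner ℝ (Y ω) t = Z ω := by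
      simp [hZ, PiLp.inner_apply]
    have hs : √v ≠ 0 := (Real.sqrt_pos.2 hpos).ne'
    rw [real_inner_smul_right, hin]
    simp only [RCLike.inner_apply, conj_trivial]
    field_simp
  · congr 2
    simp only [inner_zero_right]
    rw [← Complex.ofReal_pow, Real.sq_sqrt hpos.le]
    push_cast
    ring

/-- The multivariate central limit theorem for i.i.d. centered random vectors with nondegenerate
covariance, tested on open sets. -/
theorem le_liminf_pi_normalizedSum [IsProbabilityMeasure P] (hY : Measurable Y)
    (hY2 : ∀ i, MemLp (fun ω => Y ω i) 2 P) (hY0 : ∀ i, ∫ ω, Y ω i ∂P = 0)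
    (hS : (secondMoment P Y).PosDef) {U : Set (EuclideanSpace ℝ ι)} (hU : IsOpen U) :
    multivariateGaussian 0 (secondMoment P Y) U ≤
      liminf (fun d : ℕ => Measure.pi (fun _ : Fin d => P)
        {G | (√(d : ℝ))⁻¹ • ∑ k, Y (G k) ∈ U}) atTop := by
  have hmeas (d : ℕ) : Measurable fun G : Fin d → Ω => (√(d : ℝ))⁻¹ • ∑ k, Y (G k) := by fun_prop
  have hprob (d : ℕ) := Measure.isProbabilityMeasure_map (μ := Measure.pi (fun _ : Fin d => P))
    (hmeas d).aemeasurable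
  have h := le_liminf_of_tendsto_charFun (μ := fun d : ℕ => (Measure.pi (fun _ : Fin d => P)).map
    (fun G => (√(d : ℝ))⁻¹ • ∑ k, Y (G k))) (ν := multivariateGaussian 0 (secondMoment P Y))
    (fun t => by
      simp_rw [charFun_map_pi_normalizedSum P hY]
      exact tendsto_charFun_secondMoment hY hY2 hY0 hS t) hU
  exact h.trans_eq (congrArg (liminf · atTop) (funext fun d =>
    Measure.map_apply (hmeas d) hU.measurableSet))

end

/-! ### Discriminant and eigengaps -/

/-- The Hankel determinant `det (tr A^(i+j))`, which is the discriminant of the characteristic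
polynomial of `A`. -/
def hankelDet {R : Type*} [CommRing R] {n : ℕ} (A : Matrix (Fin n) (Fin n) R) : R :=
  (Matrix.of fun i j : Fin n => (A ^ (i + j : ℕ)).trace).det

theorem map_hankelDet {R S : Type*} [CommRing R] [CommRing S] (f : R →+* S) {n : ℕ}
    (A : Matrix (Fin n) (Fin n) R) : f (hankelDet A) = hankelDet (A.map f) := by
  rw [hankelDet, hankelDet, RingHom.map_det]
  congr 1
  ext i j
  simp only [RingHom.mapMatrix_apply, Matrix.map_apply, Matrix.of_apply, AddMonoidHom.map_trace]
  rw [← RingHom.mapMatrix_apply f (A ^ _), map_pow, RingHom.mapMatrix_apply]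

/-- The Hankel matrix of power sums factors as `VᵀV`, with `V` the Vandermonde matrix. -/
theorem hankelDet_eq_sq {R : Type*} [CommRing R] {n : ℕ} {A : Matrix (Fin n) (Fin n) R}
    {x : Fin n → R} (h : ∀ k, (A ^ k).trace = ∑ i, x i ^ k) :
    hankelDet A = (Matrix.vandermonde x).det ^ 2 := by
  rw [hankelDet, sq]
  nth_rewrite 1 [← Matrix.det_transpose (Matrix.vandermonde x)]
  rw [← Matrix.det_mul]
  congr 1
  ext i j
  rw [Matrix.of_apply, h]
  simp [Matrix.mul_apply, Matrix.vandermonde_apply, pow_add]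

theorem continuous_hankelDet (n : ℕ) :
    Continuous (hankelDet : Matrix (Fin n) (Fin n) ℝ → ℝ) := by
  unfold hankelDet
  refine Continuous.matrix_det (continuous_matrix fun i j => ?_)
  exact (continuous_id.pow _).matrix_trace

/-- The power traces of an affine image of a symmetric matrix. -/
theorem trace_pow_affine {n : ℕ} {A : Matrix (Fin n) (Fin n) ℝ} (hA : A.IsHermitian) (s m : ℝ)
    (k : ℕ) : ((s • (A - m • 1)) ^ k).trace = ∑ i, (s * (orderedEigenvalue hA i - m)) ^ k := by
  have hd : s • (A - m • 1) = Unitary.conjStarAlgAut ℝ _ hA.eigenvectorUnitary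
      (Matrix.diagonal fun i => s * (hA.eigenvalues i - m)) := by
    have : (Matrix.diagonal fun i => s * (hA.eigenvalues i - m)) =
        s • (Matrix.diagonal (RCLike.ofReal ∘ hA.eigenvalues) - m • 1) := by
      ext i j
      by_cases hij : i = j <;> simp [Matrix.diagonal, hij]
    rw [this, map_smul, map_sub, map_smul, map_one, ← hA.spectral_theorem]
  rw [hd, ← map_pow, Unitary.conjStarAlgAut_apply, Matrix.trace_mul_comm, ← mul_assoc]
  simp only [Unitary.coe_star_mul_self, one_mul, Matrix.diagonal_pow, Matrix.trace_diagonal,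
    Pi.pow_apply]
  -- `eigenvalues` is `eigenvalues₀` reindexed through an arbitrary equivalence, which `e` undoes.
  let e : Fin n ≃ Fin n :=
    ((Fintype.equivOfCardEq (Fintype.card_fin (Fintype.card (Fin n)))).symm.trans
      (finCongr (Fintype.card_fin n)))
  refine Fintype.sum_equiv e _ _ fun i => ?_
  rfl

/-- The Vandermonde determinant of points with distances at most `M` is small if two of the points
are close. -/
theorem abs_det_vandermonde_le {n : ℕ} {x : Fin n → ℝ} {M : ℝ} (hM : 1 ≤ M)
    (hx : ∀ i j, |x j - x i| ≤ M) {a b : Fin n} (hab : a < b) :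
    |(Matrix.vandermonde x).det| ≤ |x b - x a| * M ^ (n ^ 2) := by
  have hmem : (⟨a, b⟩ : Σ _ : Fin n, Fin n) ∈ Finset.univ.sigma fun i : Fin n => Finset.Ioi i := by
    simpa using hab
  have hcard : ((Finset.univ.sigma fun i : Fin n => Finset.Ioi i).erase
      (⟨a, b⟩ : Σ _ : Fin n, Fin n)).card ≤ n ^ 2 :=
    (Finset.card_le_univ _).trans_eq (by simp [sq])
  rw [Matrix.det_vandermonde, Finset.prod_sigma', Finset.abs_prod, ← Finset.mul_prod_erase _ _ hmem]
  refine mul_le_mul_of_nonneg_left ?_ (abs_nonneg _)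
  refine (Finset.prod_le_prod (fun _ _ => abs_nonneg _) fun p _ => hx p.1 p.2).trans ?_
  rw [Finset.prod_const]
  exact pow_le_pow_right₀ hM hcard

/-- If the power traces of the normalized matrix are controlled then the minimum eigengap lies in
an explicit window. -/
theorem minEigengap_bounds {n : ℕ} (hn : 2 ≤ n) {A : Matrix (Fin n) (Fin n) ℝ}
    (hA : A.IsHermitian) {s m N : ℝ} (hs : 0 < s) (hN : 1 ≤ N)
    (htr : ((s • (A - m • 1)) ^ 2).trace < N ^ 2)
    (hdisc : N⁻¹ < |hankelDet (s • (A - m • 1))|) :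
    (N * ((2 * N) ^ (n ^ 2)) ^ 2)⁻¹ ≤ s * minEigengap hA ∧ s * minEigengap hA ≤ 2 * N := by
  have hk0 (k : Fin (n - 1)) : (k : ℕ) < n := by omega
  have hk1 (k : Fin (n - 1)) : (k : ℕ) + 1 < n := by omega
  set x : Fin n → ℝ := fun i => s * (orderedEigenvalue hA i - m) with hx
  have hxN (i) : |x i| ≤ N := by
    refine abs_le_of_sq_le_sq ?_ (by linarith)
    rw [trace_pow_affine hA] at htr
    exact (Finset.single_le_sum (f := fun i => x i ^ 2) (fun _ _ => sq_nonneg _)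
      (Finset.mem_univ i)).trans htr.le
  have hdiff (i j) : |x i - x j| ≤ 2 * N := by
    have := abs_sub (x i) (x j)
    linarith [hxN i, hxN j]
  have hanti (k : Fin (n - 1)) : x ⟨k + 1, hk1 k⟩ ≤ x ⟨k, hk0 k⟩ := by
    have : orderedEigenvalue hA ⟨k + 1, hk1 k⟩ ≤ orderedEigenvalue hA ⟨k, hk0 k⟩ :=
      hA.eigenvalues₀_antitone (Nat.le_succ (k : ℕ))
    simp only [hx]
    gcongr
  have : Nonempty (Fin (n - 1)) := ⟨⟨0, by omega⟩⟩
  obtain ⟨k, hk⟩ := exists_eq_ciInf_of_finite (f := fun k : Fin (n - 1) =>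
    orderedEigenvalue hA ⟨k, hk0 k⟩ - orderedEigenvalue hA ⟨k + 1, hk1 k⟩)
  have hgap : s * minEigengap hA = x ⟨k, hk0 k⟩ - x ⟨k + 1, hk1 k⟩ := by
    rw [minEigengap, ← hk]
    simp only [hx]
    ring
  have hgap0 := hanti k
  rw [hgap]
  refine ⟨?_, (le_abs_self _).trans (hdiff _ _)⟩
  set g := x ⟨k, hk0 k⟩ - x ⟨k + 1, hk1 k⟩ with hg
  have hg0 : 0 ≤ g := sub_nonneg.2 hgap0
  have hgN : g ≤ 2 * N := (le_abs_self _).trans (hdiff _ _)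
  have hdet : |(Matrix.vandermonde x).det| ≤ g * (2 * N) ^ (n ^ 2) := by
    have h := abs_det_vandermonde_le (x := x) (M := 2 * N) (by linarith) (fun i j => hdiff j i)
      (a := ⟨k, hk0 k⟩) (b := ⟨k + 1, hk1 k⟩) (by simp [Fin.lt_def])
    rwa [abs_sub_comm, abs_of_nonneg hg0] at h
  rw [hankelDet_eq_sq (trace_pow_affine hA s m), abs_of_nonneg (sq_nonneg _), ← sq_abs] at hdisc
  have hM : 1 ≤ (2 * N) ^ (n ^ 2) := one_le_pow₀ (by linarith)
  set M := (2 * N) ^ (n ^ 2)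
  have hN0 : 0 < N := by linarith
  -- The discriminant bound only gives `N⁻¹ < g² M²`; for `g ≤ 1`, `g² ≤ g` makes it linear in `g`.
  rcases le_total 1 g with h1 | h1
  · refine (inv_le_one_of_one_le₀ ?_).trans h1
    exact one_le_mul_of_one_le_of_one_le hN (one_le_pow₀ hM)
  · have h2 : N⁻¹ ≤ g * M ^ 2 := by
      calc N⁻¹ ≤ (g * M) ^ 2 := hdisc.le.trans (pow_le_pow_left₀ (abs_nonneg _) hdet 2)
        _ = g * g * M ^ 2 := by ring
        _ ≤ g * M ^ 2 := by
          refine mul_le_mul_of_nonneg_right ?_ (sq_nonneg _)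
          exact mul_le_of_le_one_left hg0 h1
    rw [mul_inv, ← div_eq_mul_inv, div_le_iff₀ (by positivity)]
    exact h2

/-! ### The Gaussian limit of the centered Wishart matrix -/

/-- Positions on or above the diagonal of an `n × n` matrix. -/
abbrev UpperIndex (n : ℕ) : Type := {p : Fin n × Fin n // p.1 ≤ p.2}

/-- The symmetric matrix with given entries on and above the diagonal. -/
def symMat {R : Type*} {n : ℕ} (x : UpperIndex n → R) : Matrix (Fin n) (Fin n) R :=
  Matrix.of fun i j => x ⟨(min i j, max i j), min_le_max⟩

theorem continuous_symMat (n : ℕ) : Continuous (symMat : (UpperIndex n → ℝ) → _) :=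
  continuous_matrix fun _ _ => continuous_apply _

/-- The entries on and above the diagonal of `v vᵀ - I`. -/
noncomputable def centeredEntries {n : ℕ} (v : EuclideanSpace ℝ (Fin n)) :
    EuclideanSpace ℝ (UpperIndex n) :=
  WithLp.toLp 2 fun p => v p.1.1 * v p.1.2 - if p.1.1 = p.1.2 then 1 else 0

theorem measurable_centeredEntries (n : ℕ) : Measurable (centeredEntries (n := n)) := by
  unfold centeredEntries
  fun_prop

theorem symMat_normalizedSum {n d : ℕ} (s : ℝ) (G : Fin d → EuclideanSpace ℝ (Fin n)) :
    symMat (s • ∑ k, centeredEntries (G k)).ofLp =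
      s • (∑ k, Matrix.vecMulVec (G k).ofLp (G k).ofLp - (d : ℝ) • 1) := by
  ext i j
  rcases le_total i j with h | h
  · simp [symMat, centeredEntries, Matrix.sum_apply, Matrix.vecMulVec_apply, h, Matrix.one_apply]
  · simp [symMat, centeredEntries, Matrix.sum_apply, Matrix.vecMulVec_apply, h, Matrix.one_apply,
      mul_comm, eq_comm]

theorem memLp_centeredEntries {n : ℕ} (p : UpperIndex n) :
    MemLp (fun v => centeredEntries v p) 2 (stdGaussian (EuclideanSpace ℝ (Fin n))) := by
  have h4 (i : Fin n) : MemLp (fun v : EuclideanSpace ℝ (Fin n) => v i) 4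
      (stdGaussian (EuclideanSpace ℝ (Fin n))) :=
    IsGaussian.memLp_dual _ (EuclideanSpace.proj i : StrongDual ℝ (EuclideanSpace ℝ (Fin n))) 4
      (by norm_num)
  have : ENNReal.HolderTriple 4 4 2 := ⟨by
    rw [show (4 : ENNReal) = 2 * 2 by norm_num, ENNReal.mul_inv (by norm_num) (by norm_num),
      ← mul_add, ENNReal.inv_two_add_inv_two, mul_one]⟩
  exact ((h4 p.1.2).mul (h4 p.1.1)).sub (memLp_const _)

theorem integral_centeredEntries {n : ℕ} (p : UpperIndex n) :
    ∫ v, centeredEntries v p ∂(stdGaussian (EuclideanSpace ℝ (Fin n))) = 0 := by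
  have h2 (i : Fin n) : MemLp (fun v : EuclideanSpace ℝ (Fin n) => v i) 2
      (stdGaussian (EuclideanSpace ℝ (Fin n))) :=
    IsGaussian.memLp_dual _ (EuclideanSpace.proj i : StrongDual ℝ (EuclideanSpace ℝ (Fin n))) 2
      (by norm_num)
  have h0 (i : Fin n) : ∫ v : EuclideanSpace ℝ (Fin n), v i ∂(stdGaussian _) = 0 :=
    integral_strongDual_stdGaussian
      (EuclideanSpace.proj i : StrongDual ℝ (EuclideanSpace ℝ (Fin n)))
  have hcov := covariance_eval_multivariateGaussian (μ := (0 : EuclideanSpace ℝ (Fin n)))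
    Matrix.PosSemidef.one p.1.1 p.1.2
  rw [multivariateGaussian_zero_one, covariance_eq_sub (h2 _) (h2 _), h0, zero_mul, sub_zero] at hcov
  change ∫ v : EuclideanSpace ℝ (Fin n), (v p.1.1 * v p.1.2 - if p.1.1 = p.1.2 then 1 else 0)
    ∂(stdGaussian _) = 0
  have hint : Integrable (fun v : EuclideanSpace ℝ (Fin n) => v p.1.1 * v p.1.2) (stdGaussian _) :=
    (h2 _).integrable_mul (h2 _)
  simp only [Pi.mul_apply] at hcov
  rw [integral_sub hint (integrable_const _), hcov]
  simp [Matrix.one_apply]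

/-- A linear combination of the centered entries that vanishes identically is trivial. -/
theorem eq_zero_of_forall_sum_centeredEntries {n : ℕ} {t : UpperIndex n → ℝ}
    (h : ∀ v, ∑ p, t p * centeredEntries v p = 0) : t = 0 := by
  funext p₀
  obtain ⟨⟨i, j⟩, hij⟩ := p₀
  let e (i : Fin n) : EuclideanSpace ℝ (Fin n) := EuclideanSpace.single i 1
  change i ≤ j at hij
  rcases hij.eq_or_lt with rfl | hlt
  · have h1 : ∑ p, t p * (centeredEntries (e i) p - centeredEntries 0 p) = 0 := by
      simp only [mul_sub, Finset.sum_sub_distrib, h, sub_zero]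
    rw [Finset.sum_eq_single ⟨(i, i), hij⟩] at h1
    · simpa [centeredEntries, e] using h1
    · rintro ⟨⟨a, b⟩, hab⟩ - hne
      have : ¬ (a = i ∧ b = i) := fun h => hne (by simp [h.1, h.2])
      simp only [centeredEntries, e, PiLp.single_apply]
      by_cases ha : a = i <;> by_cases hb : b = i <;> simp_all
    · simp
  -- Polarization: this second difference kills every entry of `v vᵀ - I` on or above the diagonal
  -- except the one at `(i, j)`.
  · have h1 : ∑ p, t p * (centeredEntries (e i + e j) p - centeredEntries (e i) p -
        centeredEntries (e j) p + centeredEntries 0 p) = 0 := by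
      simp only [mul_sub, mul_add, Finset.sum_sub_distrib, Finset.sum_add_distrib, h, sub_zero,
        add_zero]
    rw [Finset.sum_eq_single ⟨(i, j), hij⟩] at h1
    · simpa [centeredEntries, e, PiLp.single_apply, hlt.ne, hlt.ne'] using h1
    · rintro ⟨⟨a, b⟩, hab⟩ - hne
      have h1 : ¬ (a = i ∧ b = j) := fun h => hne (by simp [h.1, h.2])
      have h2 : ¬ (a = j ∧ b = i) := fun h => by
        obtain ⟨rfl, rfl⟩ := h
        exact absurd hab (not_le.2 hlt)
      have h3 := hlt.ne
      refine mul_eq_zero_of_right _ ?_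
      simp only [centeredEntries, e, PiLp.single_apply, PiLp.add_apply, PiLp.zero_apply]
      by_cases ha : a = i <;> by_cases hb : b = j <;> by_cases ha' : a = j <;>
        by_cases hb' : b = i <;> simp_all
    · simp

/-- An almost surely vanishing combination of the entries is a polynomial vanishing on a set of full
Gaussian measure, hence identically. -/
theorem posDef_secondMoment_centeredEntries (n : ℕ) :
    (secondMoment (stdGaussian (EuclideanSpace ℝ (Fin n))) centeredEntries).PosDef := by
  refine posDef_secondMoment memLp_centeredEntries fun t ht => ?_
  let q : MvPolynomial (Fin n) ℝ := ∑ p, MvPolynomial.C (t p) *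
    (MvPolynomial.X p.1.1 * MvPolynomial.X p.1.2 - MvPolynomial.C (if p.1.1 = p.1.2 then 1 else 0))
  have hq (v : EuclideanSpace ℝ (Fin n)) :
      MvPolynomial.eval v.ofLp q = ∑ p, t p * centeredEntries v p := by
    simp only [q, map_sum, map_mul, map_sub, MvPolynomial.eval_C, MvPolynomial.eval_X]
    rfl
  refine eq_zero_of_forall_sum_centeredEntries fun v => ?_
  rw [← hq]
  suffices q = 0 by simp [this]
  by_contra hne
  have hnull := multivariateGaussian_zeros_eq_zero
    (Matrix.PosDef.one : (1 : Matrix (Fin n) (Fin n) ℝ).PosDef) hne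
  rw [multivariateGaussian_zero_one] at hnull
  have hae : ∀ᵐ v ∂(stdGaussian (EuclideanSpace ℝ (Fin n))), MvPolynomial.eval v.ofLp q ≠ 0 := by
    rw [ae_iff]
    simpa using hnull
  obtain ⟨v, hv, hv'⟩ := (ht.and hae).exists
  exact hv' ((hq v).trans hv)

/-- A nondegenerate Gaussian symmetric matrix almost surely has nonzero discriminant. -/
theorem ae_hankelDet_symMat_ne_zero {n : ℕ} {S : Matrix (UpperIndex n) (UpperIndex n) ℝ}
    (hS : S.PosDef) : ∀ᵐ x ∂(multivariateGaussian 0 S), hankelDet (symMat x.ofLp) ≠ 0 := by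
  let D : MvPolynomial (UpperIndex n) ℝ := hankelDet (symMat MvPolynomial.X)
  have hD (x : UpperIndex n → ℝ) : MvPolynomial.eval x D = hankelDet (symMat x) := by
    rw [map_hankelDet]
    congr 1
    ext i j
    simp [symMat]
  have hD0 : D ≠ 0 := by
    intro h
    -- The diagonal matrix with distinct eigenvalues `0, …, n - 1` has nonzero discriminant.
    let x : UpperIndex n → ℝ := fun p => if p.1.1 = p.1.2 then ((p.1.1 : ℕ) : ℝ) else 0
    have hx : symMat x = Matrix.diagonal fun i : Fin n => ((i : ℕ) : ℝ) := by
      ext i j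
      rcases lt_trichotomy i j with h | rfl | h
      · simp [symMat, x, h.ne]
      · simp [symMat, x]
      · simp [symMat, x, h.ne']
    have h1 := hD x
    rw [h, map_zero, hx, hankelDet_eq_sq (x := fun i : Fin n => ((i : ℕ) : ℝ))] at h1
    · refine pow_ne_zero 2 (Matrix.det_vandermonde_ne_zero_iff.2 ?_) h1.symm
      exact Nat.cast_injective.comp Fin.val_injective
    · simp [Matrix.diagonal_pow, Matrix.trace_diagonal]
  have h := multivariateGaussian_zeros_eq_zero hS hD0
  rw [ae_iff]
  simpa [hD] using h

/-! ### Passage to the limit -/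

/-- Symmetric matrices of bounded norm and with discriminant bounded away from zero, in coordinates
on and above the diagonal. -/
def gapRegion (n m : ℕ) : Set (EuclideanSpace ℝ (UpperIndex n)) :=
  {x | (symMat x.ofLp ^ 2).trace < ((m : ℝ) + 1) ^ 2 ∧
    ((m : ℝ) + 1)⁻¹ < |hankelDet (symMat x.ofLp)|}

theorem isOpen_gapRegion (n m : ℕ) : IsOpen (gapRegion n m) := by
  have hc : Continuous fun x : EuclideanSpace ℝ (UpperIndex n) => symMat x.ofLp :=
    (continuous_symMat n).comp (by fun_prop)
  exact (isOpen_lt (hc.pow 2).matrix_trace continuous_const).inter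
    (isOpen_lt continuous_const ((continuous_hankelDet n).comp hc).abs)

/-- The regions increase with `m` and exhaust the set of nonzero discriminant, which has full
measure. -/
theorem tendsto_measure_gapRegion {n : ℕ} {S : Matrix (UpperIndex n) (UpperIndex n) ℝ}
    (hS : S.PosDef) :
    Tendsto (fun m => multivariateGaussian 0 S (gapRegion n m)) atTop (𝓝 1) := by
  have hmono : Monotone (gapRegion n) := by
    rintro a b hab x ⟨h1, h2⟩
    have hab' : (a : ℝ) ≤ b := Nat.cast_le.2 hab
    exact ⟨h1.trans_le (by gcongr), lt_of_le_of_lt (by gcongr) h2⟩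
  have h := tendsto_measure_iUnion_atTop (μ := multivariateGaussian 0 S) hmono
  suffices multivariateGaussian 0 S (⋃ m, gapRegion n m) = 1 by rwa [this] at h
  rw [← prob_compl_eq_zero_iff (MeasurableSet.iUnion fun m => (isOpen_gapRegion n m).measurableSet)]
  refine measure_mono_null ?_ (ae_iff.1 (ae_hankelDet_symMat_ne_zero hS))
  intro x hx hne
  refine hx (Set.mem_iUnion.2 ?_)
  obtain ⟨m, hm⟩ := exists_nat_gt (max (symMat x.ofLp ^ 2).trace |hankelDet (symMat x.ofLp)|⁻¹)
  obtain ⟨hm1, hm2⟩ := max_lt_iff.1 hm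
  have hm0 : (0 : ℝ) ≤ m := m.cast_nonneg
  exact ⟨m, hm1.trans (by nlinarith), inv_lt_of_inv_lt₀ (abs_pos.2 hne) (hm2.trans (lt_add_one _))⟩

/-- Matrices whose centered and normalized version lies in the region `gapRegion`. -/
def gapMatrices (n m d : ℕ) : Set (Matrix (Fin n) (Fin n) ℝ) :=
  {A | A.IsHermitian ∧ (((√(d : ℝ))⁻¹ • (A - (d : ℝ) • 1)) ^ 2).trace < ((m : ℝ) + 1) ^ 2 ∧
    ((m : ℝ) + 1)⁻¹ < |hankelDet ((√(d : ℝ))⁻¹ • (A - (d : ℝ) • 1))|}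

theorem measurableSet_gapMatrices (n m d : ℕ) : MeasurableSet (gapMatrices n m d) := by
  have : BorelSpace (Matrix (Fin n) (Fin n) ℝ) :=
    inferInstanceAs (BorelSpace (Fin n → Fin n → ℝ))
  have hc : Continuous fun A : Matrix (Fin n) (Fin n) ℝ => (√(d : ℝ))⁻¹ • (A - (d : ℝ) • 1) := by
    fun_prop
  refine ((isClosed_eq (Continuous.matrix_conjTranspose continuous_id)
    continuous_id).measurableSet).inter (IsOpen.measurableSet ?_)
  exact (isOpen_lt (hc.pow 2).matrix_trace continuous_const).inter
    (isOpen_lt continuous_const ((continuous_hankelDet n).comp hc).abs)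

theorem wishart_gapMatrices (n m d : ℕ) :
    wishart n 1 d (gapMatrices n m d) =
      Measure.pi (fun _ : Fin d => stdGaussian (EuclideanSpace ℝ (Fin n)))
        {G | (√(d : ℝ))⁻¹ • ∑ k, centeredEntries (G k) ∈ gapRegion n m} := by
  rw [wishart, Measure.map_apply (wishart_map_measurable n d) (measurableSet_gapMatrices n m d),
    multivariateGaussian_zero_one]
  congr 1
  ext G
  have hherm : (∑ k, Matrix.vecMulVec (G k).ofLp (G k).ofLp).IsHermitian := by
    ext i j
    simp [Matrix.sum_apply, Matrix.vecMulVec_apply, mul_comm]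
  change (_ ∧ _) ↔ (_ ∧ _)
  rw [symMat_normalizedSum]
  exact and_iff_right hherm

/-- For fixed `m` the gap lies between constant multiples of `√d`, and `d ^ (-γ)` and `d ^ η`
eventually absorb the constants. -/
theorem gapMatrices_subset {n : ℕ} (hn : 2 ≤ n) (m : ℕ) {η γ : ℝ} (hη : 0 < η) (hγ : 0 < γ) :
    ∀ᶠ d : ℕ in atTop, ∀ A ∈ gapMatrices n m d, ∃ hA : A.IsHermitian,
      (d : ℝ) ^ (1 / 2 - γ : ℝ) ≤ minEigengap hA ∧ minEigengap hA ≤ (d : ℝ) ^ (1 / 2 + η : ℝ) := by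
  set N : ℝ := (m : ℝ) + 1 with hN
  have hN1 : 1 ≤ N := by simp [hN]
  have hc : 0 < (N * ((2 * N) ^ (n ^ 2)) ^ 2)⁻¹ := by positivity
  have h1 : ∀ᶠ d : ℕ in atTop, (d : ℝ) ^ (-γ) ≤ (N * ((2 * N) ^ (n ^ 2)) ^ 2)⁻¹ :=
    ((tendsto_rpow_neg_atTop hγ).comp tendsto_natCast_atTop_atTop).eventually_le_const hc
  have h2 : ∀ᶠ d : ℕ in atTop, 2 * N ≤ (d : ℝ) ^ η :=
    ((tendsto_rpow_atTop hη).comp tendsto_natCast_atTop_atTop).eventually_ge_atTop _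
  filter_upwards [h1, h2, eventually_gt_atTop 0] with d hd1 hd2 hd0
  rintro A ⟨hA, htr, hdisc⟩
  have hd : (0 : ℝ) < d := Nat.cast_pos.2 hd0
  have hs : 0 < √(d : ℝ) := Real.sqrt_pos.2 hd
  obtain ⟨h3, h4⟩ := minEigengap_bounds hn hA (inv_pos.2 hs) hN1 htr hdisc
  rw [inv_mul_eq_div] at h3 h4
  refine ⟨hA, ?_, ?_⟩
  · rw [sub_eq_add_neg, Real.rpow_add hd, ← Real.sqrt_eq_rpow, mul_comm]
    exact (le_div_iff₀ hs).1 (hd1.trans h3)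
  · rw [Real.rpow_add hd, ← Real.sqrt_eq_rpow, mul_comm]
    exact (div_le_iff₀ hs).1 (h4.trans hd2)

/-- The minimum eigengap of a standard Wishart matrix is of order `√d`, up to arbitrarily small
powers of `d`. -/
theorem tendsto_eigengapEvent {n : ℕ} (hn : 2 ≤ n) {Ω : ℕ → Type*} [∀ d, MeasurableSpace (Ω d)]
    (P : ∀ d, Measure (Ω d)) [∀ d, IsProbabilityMeasure (P d)]
    (W : ∀ d, Ω d → Matrix (Fin n) (Fin n) ℝ)
    (hW : ∀ d, HasLaw (W d) (wishart n (1 : Matrix (Fin n) (Fin n) ℝ) d) (P d))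
    {η γ : ℝ} (hη : 0 < η) (hγ : 0 < γ) :
    Tendsto (fun d : ℕ => P d (eigengapEvent (W d)
      ((d : ℝ) ^ (1 / 2 - γ : ℝ)) ((d : ℝ) ^ (1 / 2 + η : ℝ)))) atTop (𝓝 1) := by
  have hS := posDef_secondMoment_centeredEntries n
  refine tendsto_of_le_liminf_of_limsup_le ?_ ?_
  -- For each fixed `m` the Gaussian mass of the region bounds the limit inferior from below; only
  -- afterwards does `m` tend to infinity.
  · refine le_of_tendsto (tendsto_measure_gapRegion hS) (Eventually.of_forall fun m => ?_)
    refine (le_liminf_pi_normalizedSum (measurable_centeredEntries n) memLp_centeredEntries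
      integral_centeredEntries hS (isOpen_gapRegion n m)).trans ?_
    refine liminf_le_liminf ?_
    filter_upwards [gapMatrices_subset hn m hη hγ] with d hd
    rw [← wishart_gapMatrices, ← (hW d).map_eq,
      Measure.map_apply_of_aemeasurable (hW d).aemeasurable (measurableSet_gapMatrices n m d)]
    exact measure_mono fun ω hω => hd _ hω
  · exact limsup_le_of_le (h := Eventually.of_forall fun d => prob_le_one)

theorem mainTheorem10 (n : ℕ) (hn : 2 ≤ n)
    {Ω : ℕ → Type*} [∀ d, MeasurableSpace (Ω d)]
    (P : ∀ d, Measure (Ω d)) [∀ d, IsProbabilityMeasure (P d)]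
    (W : ∀ d, Ω d → Matrix (Fin n) (Fin n) ℝ)
    (hW : ∀ d, HasLaw (W d) (wishart n (1 : Matrix (Fin n) (Fin n) ℝ) d) (P d)) :
    (Even n → ∀ η γ : ℝ, 0 < η → ((n : ℝ) ^ 2 + n - 6) / 4 * η < γ →
      Tendsto (fun d : ℕ => P d (eigengapEvent (W d)
        ((d : ℝ) ^ (1 / 2 - γ : ℝ)) ((d : ℝ) ^ (1 / 2 + η : ℝ)))) atTop (𝓝 1)) ∧
    (Odd n → ∀ η γ : ℝ, 0 < η → 0 < γ →
      ((n : ℝ) ^ 2 + n - 6) / 4 * η - ((n : ℝ) ^ 2 + n - 2) / 8 < γ →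
      Tendsto (fun d : ℕ => P d (eigengapEvent (W d)
        ((d : ℝ) ^ (1 / 2 - γ : ℝ)) ((d : ℝ) ^ (1 / 2 + η : ℝ)))) atTop (𝓝 1)) := by
  refine ⟨fun _ η γ hη hγ => tendsto_eigengapEvent hn P W hW hη (lt_of_le_of_lt ?_ hγ),
    fun _ η γ hη hγ _ => tendsto_eigengapEvent hn P W hW hη hγ⟩
  have h2 : (2 : ℝ) ≤ n := by exact_mod_cast hn
  -- This is `(n - 2)(n + 3) ≥ 0`; it forces `γ > 0` in the even case.
  have h6 : 0 ≤ (n : ℝ) ^ 2 + n - 6 := by nlinarith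
  positivity
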